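/- Let $k$ be an algebraically closed field of characteristic $0$ and let $(R,\mathfrak m_R,k)$ be a one-dimensional complete (Noetherian) local $k$-algebra which is a domain, with residue field $k$ and embedding dimension $n$. Let $Q$ be its field of fractions, $\overline R$ its integral closure in $Q$ (a discrete valuation ring with residue field $k$, with valuation $\operatorname{ord}$), and $\mathfrak C_R=R:_Q\overline R$ its conductor. Let $x_1,\dots,x_n$ be minimal generators of $\mathfrak m_R$ and $t$ a uniformizing parameter of $\overline R$ such that $x_i=\alpha_i t^{a_i}$ with units $\alpha_i\in\overline R$, $\alpha_1=1$ and $a_1\le\dots\le a_n$; let $\Phi:k[[X_1,\dots,X_n]]\to R$ be the surjection of $k$-algebras with $X_i\mapsto x_i$. Assume $\mathfrak C_R\subseteq\mathfrak m_R^2$. Let $c$ be the least valuation of an element of $\mathfrak C_R$, and let $b_1<\dots<b_s$ be the integers $v$ with $c-a_1\le v\le c-1$ that are not of the form $\operatorname{ord}(r)$, $r\in R$. Let $S=R[\mathfrak C_R/x_1]\subseteq Q$ and $T_j=t^{b_j}\in S$; then $S=R[T_1,\dots,T_s]$. Let $\Psi:k[[X_1,\dots,X_n,T_1,\dots,T_s]]\to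 S$ be the surjection of $k$-algebras with $X_i\mapsto x_i$, $T_j\mapsto T_j$. For an analytic $k$-algebra $A=k[[Y_1,\dots,Y_m]]/I$, with $y_i$ the image of $Y_i$, the universally finite module of differentials $\Omega_A$ is the cokernel of the Jacobian matrix of $I$, that is, the $A$-module generated by $dy_1,\dots,dy_m$ with relations $\sum_i\frac{\partial f}{\partial Y_i}(y)\,dy_i=0$ for $f\in I$; $\tau(\Omega_A)$ is its torsion submodule. Form $\Omega_R$ and $\Omega_S$ with the presentations $\Phi$ and $\Psi$. Suppose that $\tau_1,\dots,\tau_N\in\tau(\Omega_S)$, with $N=ns+\binom s2+1$, are linearly independent over $k$, and that each of them can be written as $\sum_{i=1}^n r_i\,dx_i+\sum_{j=1}^s r_j'\,dT_j$ with $r_i,r_j'\in S$ and no $r_j'$ a unit of $S$. Then there is a (canonical) $R$-linear map $F:\Omega_R\to\Omega_S$ with $F(dx_i)=dx_i$ for all $i$, and there are $q_1,\dots,q_N\in k$, not all zero, and a nonzero torsion element $\omega\in\tau(\Omega_R)$ with $F(\omega)=\sum_{l=1}^N q_l\tau_l$. In particular, $\tau(\Omega_R)\neq0$. -/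

import Mathlib

noncomputable section

/-- The Jacobian relations of an analytic `k`-algebra `A` presented by `Φ : k⟦X_σ⟧ → A`
(which is meant to be surjective): the `A`-submodule of `A^σ` generated by the columns
`(∂f/∂X_i)_i`, entries read in `A`, for `f` in the defining ideal `ker Φ`. -/
def jacobianRelations {k : Type*} [Field k] {σ : Type*} {A : Type*} [CommRing A] [Algebra k A]
    (Φ : MvPowerSeries σ k →ₐ[k] A) : Submodule A (σ → A) :=
  Submodule.span A
    {v | ∃ f : MvPowerSeries σ k, Φ f = 0 ∧ v = fun i => Φ (MvPowerSeries.pderiv k i f)}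

/-- The universally finite module of differentials of the analytic `k`-algebra `A` presented by
`Φ : k⟦X_σ⟧ ↠ A`: the cokernel of the Jacobian matrix of the defining ideal. The class of a
column `r : σ → A` is `∑ i, r i • d(Φ X_i)`. -/
abbrev UnivFinDiff {k : Type*} [Field k] {σ : Type*} {A : Type*} [CommRing A] [Algebra k A]
    (Φ : MvPowerSeries σ k →ₐ[k] A) : Type _ :=
  (σ → A) ⧸ jacobianRelations Φ

/-- The element `∑ i, r i • d(Φ X_i)` of the universally finite module of differentials. -/
def UnivFinDiff.ofCoeffs {k : Type*} [Field k] {σ : Type*} {A : Type*} [CommRing A] [Algebra k A]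
    (Φ : MvPowerSeries σ k →ₐ[k] A) (r : σ → A) : UnivFinDiff Φ :=
  (jacobianRelations Φ).mkQ r

/-- The differential `d(Φ X_i)` of the `i`-th coordinate. -/
def UnivFinDiff.dX {k : Type*} [Field k] {σ : Type*} [DecidableEq σ] {A : Type*} [CommRing A]
    [Algebra k A] (Φ : MvPowerSeries σ k →ₐ[k] A) (i : σ) : UnivFinDiff Φ :=
  UnivFinDiff.ofCoeffs Φ (Pi.single i 1)

/-- The integral closure of the domain `R` in its field of fractions. -/
abbrev normalization (R : Type*) [CommRing R] [IsDomain R] : Subalgebra R (FractionRing R) :=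
  integralClosure R (FractionRing R)

/-- The conductor `R :_Q R̄`, as an `R`-submodule of `Q = Frac R`. -/
def fracConductor (R : Type*) [CommRing R] [IsDomain R] : Submodule R (FractionRing R) :=
  (1 : Submodule R (FractionRing R)) / Subalgebra.toSubmodule (normalization R)

/-- The conductor as an ideal of `R` (no element is lost, since `1 ∈ R̄` forces
`R :_Q R̄ ⊆ R`). -/
def conductorIdeal (R : Type*) [CommRing R] [IsDomain R] : Ideal R :=
  (fracConductor R).comap (Algebra.linearMap R (FractionRing R))

/-- The ring `R[C_R / x]`, as a subring of `Frac R`. -/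
def conductorTransform (R : Type*) [CommRing R] [IsDomain R] (x : R) :
    Subalgebra R (FractionRing R) :=
  Algebra.adjoin R {y | ∃ c ∈ fracConductor R, y = c / algebraMap R (FractionRing R) x}

/-- `t` is a uniformizing parameter of the domain `A`: `t ≠ 0` and `(t)` is the set of non-units,
that is, `A` is local with maximal ideal `(t)`. -/
def IsUniformizingParameter {A : Type*} [CommRing A] (t : A) : Prop :=
  t ≠ 0 ∧ ∀ y : A, t ∣ y ↔ ¬ IsUnit y

/-- `ord y = v` with respect to the uniformizing parameter `t`: `y = u t^v` with `u` a unit. -/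
def HasOrd {A : Type*} [CommRing A] (t y : A) (v : ℕ) : Prop :=
  ∃ u : Aˣ, y = u * t ^ v

/-- The valuation semigroup of `R` with respect to a uniformizing parameter `t` of `R̄`. -/
def valuationSemigroup (R : Type*) [CommRing R] [IsDomain R] (t : normalization R) : Set ℕ :=
  {v | ∃ r : R, HasOrd t (algebraMap R (normalization R) r) v}

/-- `c = c_R` is the least valuation of an element of the conductor. -/
def IsConductorExponent (R : Type*) [CommRing R] [IsDomain R] (t : normalization R) (c : ℕ) :
    Prop :=
  IsLeast {v | ∃ r ∈ conductorIdeal R, HasOrd t (algebraMap R (normalization R) r) v} c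

end

/-!
Multiplication by `p ∈ 𝔪_R` carries `T_j` into `R`, as does multiplication by `T_i`. The Leibniz
rule therefore gives `p dT_j = d(p T_j) - T_j dp` and `T_i dT_j + T_j dT_i = d(T_i T_j)`, where
`d(p T_j)` and `d(T_i T_j)` come from `Ω_R`. Since `S = R + ∑ k T_j`, every differential of `S`
whose `dT_j`-coefficients are nonunits lies in the image of `Ω_R` plus the `k`-span of the `N - 1`
elements `T_j dx_i` and `T_i dT_j` with `i < j`. Hence some nontrivial combination of the `N` given
torsion elements lies in the image of `Ω_R`. Its preimages are torsion because the kernel of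
`Ω_R → Ω_S` is: the derivation `R → Q ⊗ Ω_R` extends to `Q ⊇ S`, so `Ω_R → Q ⊗ Ω_R` factors through
`Ω_S`.
-/

section PowerSeries

open MvPowerSeries IsLocalRing

theorem exists_eq_C_add_sum_X_mul {k σ : Type*} [CommRing k] [Fintype σ] (f : MvPowerSeries σ k) :
    ∃ h : σ → MvPowerSeries σ k, f = C (constantCoeff f) + ∑ i, X i * h i := by
  classical
  rcases isEmpty_or_nonempty σ with _ | _
  · refine ⟨fun _ => 0, ?_⟩
    ext d
    simp [Subsingleton.elim d 0]
  -- Each nonconstant monomial is assigned to one of the variables dividing it.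
  have exists_var : ∀ d : σ →₀ ℕ, d ≠ 0 → ∃ i, d i ≠ 0 := fun d hd => Finsupp.ne_iff.mp hd
  choose! var hvar using exists_var
  let h : σ → MvPowerSeries σ k := fun i e =>
    if var (e + Finsupp.single i 1) = i then coeff (e + Finsupp.single i 1) f else 0
  have coeff_h (i : σ) (e : σ →₀ ℕ) : coeff e (h i) =
      if var (e + Finsupp.single i 1) = i then coeff (e + Finsupp.single i 1) f else 0 := rfl
  refine ⟨h, ?_⟩
  ext d
  rcases eq_or_ne d 0 with rfl | hd
  · simp [coeff_zero_eq_constantCoeff_apply]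
  have hle : Finsupp.single (var d) 1 ≤ d := by
    simpa [Finsupp.single_le_iff] using Nat.one_le_iff_ne_zero.mpr (hvar d hd)
  rw [map_add, coeff_C, if_neg hd, zero_add, map_sum, Finset.sum_eq_single (var d)]
  · rw [X, coeff_monomial_mul, if_pos hle, one_mul, coeff_h, tsub_add_cancel_of_le hle, if_pos rfl]
  · intro i _ hi
    rw [X, coeff_monomial_mul]
    split_ifs with hle
    · rw [one_mul, coeff_h, tsub_add_cancel_of_le hle, if_neg hi.symm]
    · rfl
  · simp

theorem iInf_maximalIdeal_pow_smul_eq_bot_of_fg {A M : Type*} [CommRing A] [IsLocalRing A]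
    [IsNoetherianRing A] [AddCommGroup M] [Module A M] {L : Submodule A M} (hL : L.FG) :
    ⨅ N : ℕ, maximalIdeal A ^ N • L = ⊥ := by
  have := Module.Finite.iff_fg.mpr hL
  have krull := Ideal.iInf_pow_smul_eq_bot_of_isLocalRing (M := L) (maximalIdeal A)
    (Ideal.IsPrime.ne_top inferInstance)
  have map_krull := congrArg (Submodule.map L.subtype) krull
  rw [Submodule.map_iInf _ L.injective_subtype, Submodule.map_bot] at map_krull
  simpa only [Submodule.map_smul'', Submodule.map_subtype_top] using map_krull

variable {k σ A M : Type*} [Field k] [CommRing A]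

theorem linearMap_eq_zero_of_map_X_mul [Finite σ] [IsLocalRing A] [IsNoetherianRing A]
    [AddCommGroup M] [Module k M] [Module A M] (E : MvPowerSeries σ k →ₗ[k] M) (h1 : E 1 = 0)
    (y : σ → A) (hy : ∀ i, y i ∈ maximalIdeal A) (hX : ∀ i f, E (X i * f) = y i • E f)
    {L : Submodule A M} (hL : L.FG) (hEL : ∀ f, E f ∈ L) : E = 0 := by
  cases nonempty_fintype σ
  have map_C (a : k) : E (C a) = 0 := by
    rw [← mul_one (C a), ← smul_eq_C_mul, map_smul, h1, smul_zero]
  have mem_pow (N : ℕ) (f : MvPowerSeries σ k) : E f ∈ maximalIdeal A ^ N • L := by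
    induction N generalizing f with
    | zero => simpa using hEL f
    | succ N ih =>
      obtain ⟨g, hg⟩ := exists_eq_C_add_sum_X_mul f
      rw [hg, map_add, map_C, zero_add, map_sum, pow_succ', mul_smul]
      exact sum_mem fun i _ => hX i (g i) ▸ Submodule.smul_mem_smul (hy i) (ih _)
  ext f
  rw [LinearMap.zero_apply, ← Submodule.mem_bot A, ← iInf_maximalIdeal_pow_smul_eq_bot_of_fg hL]
  exact Submodule.mem_iInf _ |>.mpr fun N => mem_pow N f

variable [Algebra k A]

theorem exists_sub_algebraMap_mem_span_apply_X [Finite σ] {Φ : MvPowerSeries σ k →ₐ[k] A}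
    (hΦ : Function.Surjective Φ) (r : A) :
    ∃ a : k, r - algebraMap k A a ∈ Ideal.span (Set.range fun i => Φ (X i)) := by
  cases nonempty_fintype σ
  obtain ⟨f, rfl⟩ := hΦ r
  obtain ⟨h, hf⟩ := exists_eq_C_add_sum_X_mul f
  refine ⟨constantCoeff f, ?_⟩
  have hC : Φ (C (constantCoeff f)) = algebraMap k A (constantCoeff f) := Φ.commutes _
  rw [← hC, ← map_sub, sub_eq_of_eq_add' hf, map_sum]
  exact sum_mem fun i _ => map_mul Φ (X i) (h i) ▸
    Ideal.mul_mem_right _ _ (Ideal.subset_span ⟨i, rfl⟩)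

variable [IsLocalRing A]

theorem mvPowerSeries_algHom_ext [Finite σ] [IsNoetherianRing A] {φ ψ : MvPowerSeries σ k →ₐ[k] A}
    (hψ : ∀ i, ψ (X i) ∈ maximalIdeal A) (h : ∀ i, φ (X i) = ψ (X i)) : φ = ψ := by
  have difference_eq_zero : φ.toLinearMap - ψ.toLinearMap = 0 :=
    linearMap_eq_zero_of_map_X_mul _ (by simp) (fun i => ψ (X i)) hψ (by simp [h, mul_sub])
      (Module.Finite.fg_top (R := A) (M := A)) fun _ => Submodule.mem_top
  exact AlgHom.toLinearMap_injective (sub_eq_zero.mp difference_eq_zero)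

theorem derivation_apply_eq_sum_pderiv [Fintype σ] [IsNoetherianRing A] [AddCommGroup M]
    [Module k M] [Module A M] [IsScalarTower k A M] (D : Derivation k A M)
    {φ : MvPowerSeries σ k →ₐ[k] A} (hφ : ∀ i, φ (X i) ∈ maximalIdeal A)
    {L : Submodule A M} (hL : L.FG) (hDL : ∀ y, D y ∈ L) (f : MvPowerSeries σ k) :
    D (φ f) = ∑ i, φ (pderiv k i f) • D (φ (X i)) := by
  let chain : MvPowerSeries σ k →ₗ[k] M := ∑ i,
    ((LinearMap.toSpanSingleton A M (D (φ (X i)))).restrictScalars k ∘ₗ φ.toLinearMap ∘ₗ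
      (pderiv k i).toLinearMap)
  have chain_apply (f) : chain f = ∑ i, φ (pderiv k i f) • D (φ (X i)) := by
    simp [chain]
  have chain_X (i : σ) : chain (X i) = D (φ (X i)) := by
    rw [chain_apply, Finset.sum_eq_single i]
    · simp
    · intro j _ hj
      simp [pderiv_X_of_ne hj.symm]
    · simp
  have sub_chain_eq_zero : D.toLinearMap ∘ₗ φ.toLinearMap - chain = 0 := by
    refine linearMap_eq_zero_of_map_X_mul _ ?_ (fun i => φ (X i)) hφ (fun i f => ?_) hL fun f => ?_
    · simp [chain_apply]
    · have chain_X_mul : chain (X i * f) = φ (X i) • chain f + φ f • chain (X i) := by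
        simp only [chain_apply, Derivation.leibniz, smul_eq_mul, map_add, map_mul, add_smul,
          mul_smul, Finset.sum_add_distrib, Finset.smul_sum]
      simp [chain_X_mul, chain_X, smul_sub]
    · refine sub_mem (hDL _) ?_
      rw [chain_apply]
      exact sum_mem fun i _ => L.smul_mem _ (hDL _)
  rw [← chain_apply]
  exact sub_eq_zero.mp (LinearMap.congr_fun sub_chain_eq_zero f)

variable {Φ : MvPowerSeries σ k →ₐ[k] A}

theorem apply_X_mem_maximalIdeal (hΦ : Function.Surjective Φ) (i : σ) :
    Φ (X i) ∈ maximalIdeal A := by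
  have := hΦ.isLocalHom (f := Φ.toRingHom)
  rw [mem_maximalIdeal, mem_nonunits_iff]
  intro h
  simpa [isUnit_iff_constantCoeff] using isUnit_of_map_unit Φ.toRingHom (X i) h

theorem maximalIdeal_eq_span_apply_X [Finite σ] (hΦ : Function.Surjective Φ) :
    maximalIdeal A = Ideal.span (Set.range fun i => Φ (X i)) := by
  have span_le : Ideal.span (Set.range fun i => Φ (X i)) ≤ maximalIdeal A :=
    Ideal.span_le.mpr (Set.range_subset_iff.mpr (apply_X_mem_maximalIdeal hΦ))
  refine le_antisymm (fun r hr => ?_) span_le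
  obtain ⟨a, ha⟩ := exists_sub_algebraMap_mem_span_apply_X hΦ r
  have algebraMap_mem : algebraMap k A a ∈ maximalIdeal A := by
    simpa using sub_mem hr (span_le ha)
  have a_eq_zero : a = 0 := by
    by_contra h
    exact algebraMap_mem ((Ne.isUnit h).map (algebraMap k A))
  simpa [a_eq_zero] using ha

theorem dvd_map_of_mem_maximalIdeal [Finite σ] (hΦ : Function.Surjective Φ) {B : Type*} [CommRing B]
    (f : A →+* B) {y : B} (hy : ∀ i, y ∣ f (Φ (X i))) {r : A} (hr : r ∈ maximalIdeal A) :
    y ∣ f r := by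
  have le_comap : maximalIdeal A ≤ (Ideal.span {y}).comap f := by
    rw [maximalIdeal_eq_span_apply_X hΦ, Ideal.span_le, Set.range_subset_iff]
    exact fun i => Ideal.mem_span_singleton.mpr (hy i)
  exact Ideal.mem_span_singleton.mp (le_comap hr)

end PowerSeries

noncomputable section Differentials

open MvPowerSeries IsLocalRing

namespace UnivFinDiff

section Derivation

variable {k σ A M : Type*} [Field k] [CommRing A] [Algebra k A]
  {Φ : MvPowerSeries σ k →ₐ[k] A} (hΦ : Function.Surjective Φ)

variable (Φ) in
/-- The `k`-linear map `f ↦ ∑ i, Φ (∂f/∂X_i) • d(Φ X_i)` on power series, which descends to the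
universally finite derivation of `A`. -/
def totalDifferential : MvPowerSeries σ k →ₗ[k] UnivFinDiff Φ :=
  (jacobianRelations Φ).mkQ.restrictScalars k ∘ₗ
    LinearMap.pi fun i => Φ.toLinearMap ∘ₗ (pderiv k i).toLinearMap

theorem totalDifferential_mul (f g : MvPowerSeries σ k) :
    totalDifferential Φ (f * g) = Φ f • totalDifferential Φ g + Φ g • totalDifferential Φ f := by
  simp only [totalDifferential, LinearMap.comp_apply, LinearMap.restrictScalars_apply, ← map_smul,
    ← map_add]
  congr 1
  ext i
  simp [Derivation.leibniz]

theorem totalDifferential_eq_of_apply_eq {f g : MvPowerSeries σ k} (h : Φ f = Φ g) :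
    totalDifferential Φ f = totalDifferential Φ g := by
  rw [← sub_eq_zero, ← map_sub]
  exact (Submodule.Quotient.mk_eq_zero _).mpr
    (Submodule.subset_span ⟨f - g, by rw [map_sub, h, sub_self], rfl⟩)

/-- The universally finite derivation `d : A → Ω_A`; it is defined on all of `A` because the
presentation `Φ` is surjective. -/
def d : Derivation k A (UnivFinDiff Φ) :=
  have Φ_surjInv := Function.surjInv_eq hΦ
  Derivation.mk'
    { toFun y := totalDifferential Φ (Function.surjInv hΦ y)
      map_add' x y := by
        rw [← map_add]
        exact totalDifferential_eq_of_apply_eq (by simp [Φ_surjInv])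
      map_smul' a x := by
        rw [RingHom.id_apply, ← map_smul]
        exact totalDifferential_eq_of_apply_eq (by simp [Φ_surjInv]) }
    fun x y => by
      have leibniz := totalDifferential_mul (Φ := Φ) (Function.surjInv hΦ x) (Function.surjInv hΦ y)
      rw [Φ_surjInv, Φ_surjInv] at leibniz
      rw [LinearMap.coe_mk, AddHom.coe_mk, ← leibniz]
      exact totalDifferential_eq_of_apply_eq (by simp [Φ_surjInv])

theorem d_apply (f : MvPowerSeries σ k) : d hΦ (Φ f) = ofCoeffs Φ fun i => Φ (pderiv k i f) :=
  totalDifferential_eq_of_apply_eq (Function.surjInv_eq hΦ (Φ f))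

theorem d_apply_X [DecidableEq σ] (i : σ) : d hΦ (Φ (X i)) = dX Φ i := by
  rw [d_apply, dX]
  congr 1
  ext j
  rcases eq_or_ne j i with rfl | hij
  · simp
  · simp [pderiv_X_of_ne hij.symm, hij]

theorem ofCoeffs_eq_sum [Fintype σ] (r : σ → A) : ofCoeffs Φ r = ∑ i, r i • d hΦ (Φ (X i)) := by
  classical
  simp only [d_apply_X, dX, ofCoeffs, ← map_smul, ← map_sum]
  congr 1
  ext j
  simp [Pi.single_apply]

theorem linearMap_ext [Finite σ] [AddCommGroup M] [Module A M] {F G : UnivFinDiff Φ →ₗ[A] M}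
    (h : ∀ y, F (d hΦ y) = G (d hΦ y)) : F = G := by
  cases nonempty_fintype σ
  ext r
  change F (ofCoeffs Φ r) = G (ofCoeffs Φ r)
  simp [ofCoeffs_eq_sum hΦ, h]

end Derivation

section Lift

variable {k σ A M : Type*} [Field k] [Fintype σ] [CommRing A] [Algebra k A] [AddCommGroup M]
  [Module k M] [Module A M] {Φ : MvPowerSeries σ k →ₐ[k] A} (hΦ : Function.Surjective Φ)

/-- The `A`-linear map `Ω_A → M` attached to a derivation `D : A → M` that obeys the chain rule for
power series in the generators of `A`. -/
def lift (D : Derivation k A M)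
    (hD : ∀ f, D (Φ f) = ∑ i, Φ (pderiv k i f) • D (Φ (X i))) : UnivFinDiff Φ →ₗ[A] M :=
  (jacobianRelations Φ).liftQ (Fintype.linearCombination A fun i => D (Φ (X i))) <| by
    refine Submodule.span_le.mpr ?_
    rintro _ ⟨f, hf, rfl⟩
    simp [Fintype.linearCombination_apply, ← hD, hf]

theorem lift_d (D : Derivation k A M)
    (hD : ∀ f, D (Φ f) = ∑ i, Φ (pderiv k i f) • D (Φ (X i))) (y : A) :
    lift D hD (d hΦ y) = D y := by
  obtain ⟨f, rfl⟩ := hΦ y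
  rw [d_apply, hD]
  rfl

end Lift

section Map

variable {k σ τ R S : Type*} [Field k] [Fintype σ] [Finite τ] [CommRing R] [IsLocalRing R]
  [IsNoetherianRing R] [Algebra k R] [CommRing S] [Algebra k S] [Algebra R S] [IsScalarTower k R S]
  [Module.Finite R S] {Φ : MvPowerSeries σ k →ₐ[k] R} (hΦ : Function.Surjective Φ)
  {Ψ : MvPowerSeries τ k →ₐ[k] S} (hΨ : Function.Surjective Ψ)

include hΦ in
theorem d_algebraMap_apply_eq_sum_pderiv (f : MvPowerSeries σ k) :
    (d hΨ).compAlgebraMap R (Φ f) =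
      ∑ i, Φ (pderiv k i f) • (d hΨ).compAlgebraMap R (Φ (X i)) :=
  have : Module.Finite R (UnivFinDiff Ψ) := .trans S _
  derivation_apply_eq_sum_pderiv _ (apply_X_mem_maximalIdeal hΦ) Module.Finite.fg_top
    (fun _ => Submodule.mem_top) f

/-- The canonical map `Ω_R → Ω_S`, `dr ↦ dr`, for an analytic algebra `S` finite over `R`. -/
def map : UnivFinDiff Φ →ₗ[R] UnivFinDiff Ψ :=
  lift ((d hΨ).compAlgebraMap R) (d_algebraMap_apply_eq_sum_pderiv hΦ hΨ)

theorem map_d (r : R) : map hΦ hΨ (d hΦ r) = d hΨ (algebraMap R S r) :=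
  lift_d hΦ _ (d_algebraMap_apply_eq_sum_pderiv hΦ hΨ) r

end Map

end UnivFinDiff

end Differentials

section Torsion

open MvPowerSeries IsLocalRing TensorProduct
open scoped nonZeroDivisors

theorem exists_derivation_extension_of_formallyEtale {k R Q M : Type*} [CommRing k] [CommRing R]
    [CommRing Q] [Algebra k R] [Algebra k Q] [Algebra R Q] [IsScalarTower k R Q]
    [Algebra.FormallyEtale R Q] [AddCommGroup M] [Module k M] [Module R M] [Module Q M]
    [IsScalarTower R Q M] [IsScalarTower k R M] [IsScalarTower k Q M] (D : Derivation k R M) :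
    ∃ D' : Derivation k Q M, ∀ r, D' (algebraMap R Q r) = D r := by
  have baseChange := KaehlerDifferential.isBaseChange_of_formallyEtale k R Q
  refine ⟨(baseChange.lift D.liftKaehlerDifferential).compDer (KaehlerDifferential.D k Q), ?_⟩
  intro r
  have := baseChange.lift_eq D.liftKaehlerDifferential (KaehlerDifferential.D k R r)
  rwa [KaehlerDifferential.map_D, Derivation.liftKaehlerDifferential_comp_D] at this

theorem exists_fg_forall_derivation_mem {k R S M : Type*} [CommRing k] [CommRing R] [CommRing S]
    [Algebra k S] [Algebra R S] [Module.Finite R S] [AddCommGroup M] [Module k M] [Module R M]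
    [Module S M] [IsScalarTower R S M] (D : Derivation k S M) {N : Submodule R M} (hN : N.FG)
    (hDN : ∀ r : R, D (algebraMap R S r) ∈ N) :
    ∃ L : Submodule S M, L.FG ∧ ∀ y, D y ∈ L := by
  obtain ⟨gens, hgens⟩ := Module.Finite.fg_top (R := R) (M := S)
  obtain ⟨Ngens, rfl⟩ := hN
  let L : Submodule S M := Submodule.span S Ngens ⊔ Submodule.span S (D '' gens)
  have span_le : Submodule.span R (Ngens : Set M) ≤ L.restrictScalars R :=
    Submodule.span_le.mpr fun m hm => Submodule.mem_sup_left (Submodule.subset_span hm)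
  refine ⟨L, (Submodule.fg_span Ngens.finite_toSet).sup
    (Submodule.fg_span (gens.finite_toSet.image D)), fun y => ?_⟩
  have hy : y ∈ Submodule.span R (gens : Set S) := hgens ▸ Submodule.mem_top
  induction hy using Submodule.span_induction with
  | mem y hy => exact Submodule.mem_sup_right (Submodule.subset_span ⟨y, hy, rfl⟩)
  | zero => simp
  | add y z _ _ hy hz => simpa using add_mem hy hz
  | smul r y _ hy =>
    rw [Algebra.smul_def, D.leibniz]
    exact add_mem (L.smul_mem _ hy) (L.smul_mem _ (span_le (hDN r)))

namespace UnivFinDiff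

variable {k σ τ R S : Type*} [Field k] [Fintype σ] [Finite τ] [CommRing R] [IsLocalRing R]
  [IsNoetherianRing R] [Algebra k R] [CommRing S] [IsLocalRing S] [Algebra k S] [Algebra R S]
  [IsScalarTower k R S] [Module.Finite R S]
  {Φ : MvPowerSeries σ k →ₐ[k] R} (hΦ : Function.Surjective Φ)
  {Ψ : MvPowerSeries τ k →ₐ[k] S} (hΨ : Function.Surjective Ψ)
  (Q : Type*) [Field Q] [Algebra k Q] [Algebra R Q] [IsFractionRing R Q] [Algebra S Q]
  [IsScalarTower k R Q] [IsScalarTower k S Q] [IsScalarTower R S Q]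

theorem exists_linearMap_map_eq_one_tmul :
    ∃ G : UnivFinDiff Ψ →ₗ[S] Q ⊗[R] UnivFinDiff Φ, ∀ ω, G (map hΦ hΨ ω) = 1 ⊗ₜ ω := by
  cases nonempty_fintype τ
  have : IsNoetherianRing S := .of_finite R S
  have : Algebra.FormallyEtale R Q := .of_isLocalization R⁰
  let ι : UnivFinDiff Φ →ₗ[R] Q ⊗[R] UnivFinDiff Φ := TensorProduct.mk R Q _ 1
  obtain ⟨D, hD⟩ := exists_derivation_extension_of_formallyEtale (Q := Q) (ι.compDer (d hΦ))
  have D_algebraMap (r : R) : D.compAlgebraMap S (algebraMap R S r) = ι (d hΦ r) := by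
    rw [Derivation.compAlgebraMap_apply, ← IsScalarTower.algebraMap_apply, hD]
    rfl
  obtain ⟨L, hL, hDL⟩ := exists_fg_forall_derivation_mem (D.compAlgebraMap S)
    (Module.Finite.fg_top.map ι) fun r => D_algebraMap r ▸ Submodule.mem_map_of_mem trivial
  let G := lift (D.compAlgebraMap S)
    (derivation_apply_eq_sum_pderiv _ (apply_X_mem_maximalIdeal hΨ) hL hDL)
  have G_comp_map : G.restrictScalars R ∘ₗ map hΦ hΨ = ι := linearMap_ext hΦ fun r => by
    rw [LinearMap.comp_apply, map_d, LinearMap.restrictScalars_apply, lift_d, D_algebraMap]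
  exact ⟨G, LinearMap.congr_fun G_comp_map⟩

theorem mem_torsion_of_map_mem_torsion [FaithfulSMul S Q] {ω : UnivFinDiff Φ}
    (hω : map hΦ hΨ ω ∈ Submodule.torsion S (UnivFinDiff Ψ)) :
    ω ∈ Submodule.torsion R (UnivFinDiff Φ) := by
  obtain ⟨G, hG⟩ := exists_linearMap_map_eq_one_tmul hΦ hΨ Q
  obtain ⟨y, hy⟩ := (Submodule.mem_torsion_iff _).mp hω
  have y_ne_zero : algebraMap S Q y ≠ 0 := fun h =>
    nonZeroDivisors.coe_ne_zero y ((FaithfulSMul.algebraMap_eq_zero_iff S Q).mp h)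
  have smul_eq_zero : algebraMap S Q y • G (map hΦ hΨ ω) = 0 := by
    rw [algebraMap_smul, ← map_smul]
    exact (congrArg G hy).trans (map_zero G)
  have one_tmul_eq_zero : TensorProduct.mk R Q _ 1 ω = 0 :=
    (hG ω).symm.trans ((smul_eq_zero_iff_right y_ne_zero).mp smul_eq_zero)
  exact (Submodule.mem_torsion_iff _).mpr
    ((IsLocalizedModule.eq_zero_iff R⁰ _).mp one_tmul_eq_zero)

end UnivFinDiff

end Torsion

section SmallExtension

open MvPowerSeries IsLocalRing

/-- `S` is an extension of the local `k`-algebra `R` by elements `T_j` with `S = R + ∑ j, k T_j`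
such that the maximal ideal of `R` multiplies every `T_j` into `R` and `T_i T_j ∈ R`. The transform
`R[C_R / x_1]` is of this kind, with `T_j = t ^ b_j`. -/
structure IsSmallExtension (k R : Type*) {S τ : Type*} [Field k] [CommRing R] [IsLocalRing R]
    [CommRing S] [Algebra k S] [Algebra R S] [Fintype τ] (T : τ → S) : Prop where
  exists_eq_add_sum (y : S) : ∃ (r : R) (q : τ → k), y = algebraMap R S r + ∑ j, q j • T j
  exists_eq_smul {p : R} (hp : p ∈ maximalIdeal R) (j : τ) : ∃ r, algebraMap R S r = p • T j
  exists_eq_mul (i j : τ) : ∃ r, algebraMap R S r = T i * T j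

/-- The differentials `T_j dx_i` and `T_i dT_j`, `i < j`, for a derivation `d` of `S`. -/
def mixedDifferentials {k S M σ τ : Type*} [Field k] [CommRing S] [Algebra k S] [AddCommGroup M]
    [Module k M] [Module S M] [LT τ] (D : Derivation k S M) (x : σ → S) (T : τ → S) :
    (σ × τ) ⊕ {p : τ × τ // p.1 < p.2} → M :=
  Sum.elim (fun p => T p.2 • D (x p.1)) fun p => T p.1.1 • D (T p.1.2)

/-- The `k`-subspace `∑ R dx_i + ∑ k T_j dx_i + ∑ k T_i dT_j`, the second sum over all pairs and
the third over `i < j`. -/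
def reducedDifferentials {k R S M σ τ : Type*} [Field k] [CommRing R] [CommRing S] [Algebra k R]
    [Algebra k S] [Algebra R S] [AddCommGroup M] [Module k M] [Module R M] [Module S M]
    [IsScalarTower k R M] [LT τ] (D : Derivation k S M) (x : σ → R) (T : τ → S) : Submodule k M :=
  (Submodule.span R (Set.range fun i => D (algebraMap R S (x i)))).restrictScalars k ⊔
    Submodule.span k (Set.range (mixedDifferentials D (algebraMap R S ∘ x) T))

namespace IsSmallExtension

variable {k R S M σ τ : Type*} [Field k] [CommRing R] [IsLocalRing R] [CommRing S] [Algebra k S]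
  [Algebra R S] [Fintype τ] {T : τ → S}

theorem finite [Algebra k R] [IsScalarTower k R S] (hT : IsSmallExtension k R T) :
    Module.Finite R S := by
  have top_eq : (⊤ : Submodule R S) = Submodule.span R (insert 1 (Set.range T)) := by
    refine (eq_top_iff.mpr fun y _ => ?_).symm
    obtain ⟨r, q, rfl⟩ := hT.exists_eq_add_sum y
    refine add_mem ?_ (sum_mem fun j _ => ?_)
    · rw [Algebra.algebraMap_eq_smul_one]
      exact Submodule.smul_mem _ _ (Submodule.subset_span (Set.mem_insert _ _))
    · exact Submodule.smul_of_tower_mem _ _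
        (Submodule.subset_span (Set.mem_insert_of_mem _ ⟨j, rfl⟩))
  exact ⟨top_eq ▸ Submodule.fg_span ((Set.finite_range _).insert _)⟩

theorem mem_maximalIdeal [IsLocalRing S] (hTm : ∀ j, T j ∈ maximalIdeal S) {r : R} {q : τ → k}
    (h : algebraMap R S r + ∑ j, q j • T j ∈ maximalIdeal S) : r ∈ maximalIdeal R := by
  have sum_mem : ∑ j, q j • T j ∈ maximalIdeal S :=
    sum_mem fun j _ => Submodule.smul_of_tower_mem _ (q j) (hTm j)
  have algebraMap_mem : algebraMap R S r ∈ maximalIdeal S := by simpa using sub_mem h sum_mem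
  exact fun hr => algebraMap_mem (hr.map (algebraMap R S))

variable [Algebra k R] [AddCommGroup M] [Module k M] [Module R M] [Module S M]
  [IsScalarTower k R M] [LinearOrder τ] {D : Derivation k S M} {x : σ → R}

theorem smul_apply_mem (hT : IsSmallExtension k R T)
    (hD : ∀ r, D (algebraMap R S r) ∈
      Submodule.span R (Set.range fun i => D (algebraMap R S (x i))))
    (two_ne_zero : (2 : k) ≠ 0) (i j : τ) :
    T i • D (T j) ∈ reducedDifferentials D x T := by
  have add_swap_mem (i j : τ) : T i • D (T j) + T j • D (T i) ∈ reducedDifferentials D x T := by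
    obtain ⟨r, hr⟩ := hT.exists_eq_mul i j
    rw [← D.leibniz, ← hr]
    exact Submodule.mem_sup_left (hD r)
  have mem_of_lt {i j : τ} (hij : i < j) : T i • D (T j) ∈ reducedDifferentials D x T :=
    Submodule.mem_sup_right (Submodule.subset_span ⟨.inr ⟨(i, j), hij⟩, rfl⟩)
  rcases lt_trichotomy i j with hij | rfl | hji
  · exact mem_of_lt hij
  · have := Submodule.smul_mem _ (2⁻¹ : k) (add_swap_mem i i)
    rwa [← two_smul k, smul_smul, inv_mul_cancel₀ two_ne_zero, one_smul] at this
  · exact (Submodule.add_mem_iff_left _ (mem_of_lt hji)).mp (add_swap_mem i j)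

variable [IsScalarTower k S M] [IsScalarTower R S M]

theorem smul_apply_generator_mem (hT : IsSmallExtension k R T) (y : S) (i : σ) :
    y • D (algebraMap R S (x i)) ∈ reducedDifferentials D x T := by
  obtain ⟨r, q, rfl⟩ := hT.exists_eq_add_sum y
  rw [add_smul, Finset.sum_smul, algebraMap_smul]
  refine add_mem (Submodule.mem_sup_left ?_) (sum_mem fun j _ => ?_)
  · exact Submodule.smul_mem _ r (Submodule.subset_span ⟨i, rfl⟩)
  · rw [smul_assoc]
    exact Submodule.smul_mem _ _
      (Submodule.mem_sup_right (Submodule.subset_span ⟨.inl (i, j), rfl⟩))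

theorem smul_mem_of_mem_span (hT : IsSmallExtension k R T) (y : S) {ω : M}
    (hω : ω ∈ Submodule.span R (Set.range fun i => D (algebraMap R S (x i)))) :
    y • ω ∈ reducedDifferentials D x T := by
  induction hω using Submodule.span_induction generalizing y with
  | mem _ h =>
    obtain ⟨i, rfl⟩ := h
    exact hT.smul_apply_generator_mem y i
  | zero => simp
  | add _ _ _ _ h₁ h₂ => simpa only [smul_add] using add_mem (h₁ y) (h₂ y)
  | smul p ω _ h =>
    rw [← algebraMap_smul S p ω, smul_smul]
    exact h _

variable (hT : IsSmallExtension k R T)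
  (hD : ∀ r, D (algebraMap R S r) ∈ Submodule.span R (Set.range fun i => D (algebraMap R S (x i))))
include hT hD

theorem maximalIdeal_smul_apply_mem {p : R} (hp : p ∈ maximalIdeal R) (j : τ) :
    p • D (T j) ∈ reducedDifferentials D x T := by
  obtain ⟨r, hr⟩ := hT.exists_eq_smul hp j
  have leibniz : p • D (T j) + T j • D (algebraMap R S p) = D (algebraMap R S r) := by
    rw [hr, Algebra.smul_def, D.leibniz, algebraMap_smul]
  refine (Submodule.add_mem_iff_left _ (hT.smul_mem_of_mem_span (T j) (hD p))).mp ?_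
  exact leibniz ▸ Submodule.mem_sup_left (hD r)

theorem sum_smul_apply_mem [Fintype σ] [IsLocalRing S]
    (two_ne_zero : (2 : k) ≠ 0) (hTm : ∀ j, T j ∈ maximalIdeal S) (r : σ ⊕ τ → S)
    (hr : ∀ j, r (.inr j) ∈ maximalIdeal S) :
    ∑ i, r (.inl i) • D (algebraMap R S (x i)) + ∑ j, r (.inr j) • D (T j) ∈
      reducedDifferentials D x T := by
  refine add_mem (sum_mem fun i _ => hT.smul_apply_generator_mem _ i) (sum_mem fun j _ => ?_)
  obtain ⟨p, q, hpq⟩ := hT.exists_eq_add_sum (r (.inr j))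
  have hp : p ∈ maximalIdeal R := mem_maximalIdeal hTm (hpq ▸ hr j)
  rw [hpq, add_smul, Finset.sum_smul, algebraMap_smul]
  refine add_mem (hT.maximalIdeal_smul_apply_mem hD hp j) (sum_mem fun i _ => ?_)
  rw [smul_assoc]
  exact Submodule.smul_mem _ _ (hT.smul_apply_mem hD two_ne_zero i j)

end IsSmallExtension

end SmallExtension

section Descent

open MvPowerSeries IsLocalRing

theorem exists_ne_zero_sum_mem_of_card_lt {k V ι κ : Type*} [Field k] [AddCommGroup V] [Module k V]
    [Fintype ι] [Fintype κ] {I : Submodule k V} {w : κ → V} {v : ι → V}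
    (hv : ∀ l, v l ∈ I ⊔ Submodule.span k (Set.range w))
    (hcard : Fintype.card κ < Fintype.card ι) : ∃ q : ι → k, q ≠ 0 ∧ ∑ l, q l • v l ∈ I := by
  have mkQ_mem : Set.range (I.mkQ ∘ v) ⊆ Submodule.span k (Set.range (I.mkQ ∘ w)) := by
    rintro _ ⟨l, rfl⟩
    have := Submodule.mem_map_of_mem (f := I.mkQ) (hv l)
    rwa [Submodule.map_sup, Submodule.mkQ_map_self, bot_sup_eq, Submodule.map_span,
      ← Set.range_comp] at this
  have dependent : ¬ LinearIndependent k (I.mkQ ∘ v) := fun hli => by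
    classical
    have card_le := linearIndependent_le_span_aux' _ hli _ mkQ_mem
    exact hcard.not_ge (card_le.trans (Fintype.card_range_le _))
  rw [Fintype.not_linearIndependent_iff] at dependent
  obtain ⟨q, hq, l, hl⟩ := dependent
  refine ⟨q, fun h => hl (congrFun h l), ?_⟩
  rw [← Submodule.Quotient.mk_eq_zero, ← Submodule.mkQ_apply, map_sum]
  simpa using hq

variable {k σ τ R S : Type*} [Field k] [Fintype τ] [CommRing R] [IsLocalRing R]
  [IsNoetherianRing R] [Algebra k R] [CommRing S] [IsLocalRing S] [Algebra k S] [Algebra R S]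
  [IsScalarTower k R S] {Φ : MvPowerSeries σ k →ₐ[k] R} (hΦ : Function.Surjective Φ)
  {Ψ : MvPowerSeries (σ ⊕ τ) k →ₐ[k] S}
  (hX : ∀ i, Ψ (X (.inl i)) = algebraMap R S (Φ (X i)))
  (hT : IsSmallExtension k R fun j => Ψ (X (.inr j)))
include hΦ hX hT

theorem IsSmallExtension.surjective [Finite σ] [FaithfulSMul R S] : Function.Surjective Ψ := by
  have := hT.finite
  have : IsNoetherianRing S := .of_finite R S
  have rename_inl : Ψ.comp (rename (Function.Embedding.inl : σ ↪ σ ⊕ τ)) =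
      (IsScalarTower.toAlgHom k R S).comp Φ := by
    refine mvPowerSeries_algHom_ext (fun i => ?_) fun i => by simp [hX]
    exact (map_mem_nonunits_iff (algebraMap R S) _).mpr (apply_X_mem_maximalIdeal hΦ i)
  intro y
  obtain ⟨r, q, rfl⟩ := hT.exists_eq_add_sum y
  obtain ⟨f, rfl⟩ := hΦ r
  refine ⟨rename Function.Embedding.inl f + ∑ j, q j • X (.inr j), ?_⟩
  simpa using DFunLike.congr_fun rename_inl f

variable [Module.Finite R S] [LinearOrder τ] (hΨ : Function.Surjective Ψ)

theorem ofCoeffs_mem_reducedDifferentials [Finite σ] (two_ne_zero : (2 : k) ≠ 0)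
    {r : σ ⊕ τ → S} (hr : ∀ j, ¬ IsUnit (r (.inr j))) :
    UnivFinDiff.ofCoeffs Ψ r ∈ reducedDifferentials (UnivFinDiff.d hΨ) (fun i => Φ (X i))
      fun j => Ψ (X (.inr j)) := by
  cases nonempty_fintype σ
  simp only [UnivFinDiff.ofCoeffs_eq_sum hΨ, Fintype.sum_sum_type, hX]
  refine hT.sum_smul_apply_mem (fun p => ?_) two_ne_zero
    (fun j => apply_X_mem_maximalIdeal hΨ _) r hr
  obtain ⟨f, rfl⟩ := hΦ p
  refine (UnivFinDiff.d_algebraMap_apply_eq_sum_pderiv hΦ hΨ f).symm ▸ sum_mem fun i _ => ?_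
  exact Submodule.smul_mem _ _ (Submodule.subset_span ⟨i, rfl⟩)

theorem exists_torsion_map_eq_sum [Fintype σ] (two_ne_zero : (2 : k) ≠ 0) (Q : Type*) [Field Q]
    [Algebra k Q] [Algebra R Q] [IsFractionRing R Q] [Algebra S Q] [FaithfulSMul S Q]
    [IsScalarTower k R Q] [IsScalarTower k S Q] [IsScalarTower R S Q]
    {ι : Type*} [Fintype ι]
    (hcard : Fintype.card σ * Fintype.card τ + (Fintype.card τ).choose 2 < Fintype.card ι)
    {v : ι → UnivFinDiff Ψ} (hv : LinearIndependent k v)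
    (v_torsion : ∀ l, v l ∈ Submodule.torsion S (UnivFinDiff Ψ))
    (v_nonunit : ∀ l, ∃ r, v l = UnivFinDiff.ofCoeffs Ψ r ∧ ∀ j, ¬ IsUnit (r (.inr j))) :
    ∃ (q : ι → k) (ω : UnivFinDiff Φ), q ≠ 0 ∧ ω ∈ Submodule.torsion R (UnivFinDiff Φ) ∧ ω ≠ 0 ∧
      UnivFinDiff.map hΦ hΨ ω = ∑ l, q l • v l := by
  have card_mixed : Fintype.card ((σ × τ) ⊕ {p : τ × τ // p.1 < p.2}) < Fintype.card ι := by
    rwa [Fintype.card_sum, Fintype.card_prod, Fintype.card_subtype,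
      Fintype.card_product_filter_lt]
  have v_mem (l : ι) : v l ∈ reducedDifferentials (UnivFinDiff.d hΨ) (fun i => Φ (X i))
      fun j => Ψ (X (.inr j)) := by
    obtain ⟨r, hr, hru⟩ := v_nonunit l
    exact hr ▸ ofCoeffs_mem_reducedDifferentials hΦ hX hT hΨ two_ne_zero hru
  obtain ⟨q, hq, hsum⟩ := exists_ne_zero_sum_mem_of_card_lt v_mem card_mixed
  have span_le_range : Submodule.span R (Set.range fun i => UnivFinDiff.d hΨ
      (algebraMap R S (Φ (X i)))) ≤ LinearMap.range (UnivFinDiff.map hΦ hΨ) :=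
    Submodule.span_le.mpr (Set.range_subset_iff.mpr fun i => ⟨_, UnivFinDiff.map_d hΦ hΨ _⟩)
  obtain ⟨ω, hω⟩ := span_le_range hsum
  have sum_torsion : ∑ l, q l • v l ∈ Submodule.torsion S (UnivFinDiff Ψ) :=
    sum_mem fun l _ => Submodule.smul_of_tower_mem _ (q l) (v_torsion l)
  refine ⟨q, ω, hq, UnivFinDiff.mem_torsion_of_map_mem_torsion hΦ hΨ Q (hω ▸ sum_torsion), ?_, hω⟩
  rintro rfl
  exact hq (funext (Fintype.linearIndependent_iff.mp hv q (hω.symm.trans (map_zero _))))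

end Descent

section Uniformizer

open IsLocalRing

namespace IsUniformizingParameter

variable {A : Type*} [CommRing A] {t : A} (ht : IsUniformizingParameter t)
include ht

theorem isLocalRing : IsLocalRing A := by
  have : Nontrivial A := ⟨t, 0, ht.1⟩
  refine .of_nonunits_add fun y z hy hz => ?_
  rw [mem_nonunits_iff, ← ht.2] at hy hz ⊢
  exact dvd_add hy hz

theorem dvd_iff_mem_maximalIdeal [IsLocalRing A] {y : A} : t ∣ y ↔ y ∈ maximalIdeal A :=
  ht.2 y

theorem pow_dvd_or_hasOrd (y : A) (m : ℕ) : t ^ m ∣ y ∨ ∃ v < m, HasOrd t y v := by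
  induction m with
  | zero => simp
  | succ m ih =>
    rcases ih with ⟨z, rfl⟩ | ⟨v, hv, h⟩
    · by_cases hz : IsUnit z
      · exact .inr ⟨m, m.lt_succ_self, hz.unit, mul_comm _ _⟩
      · obtain ⟨w, rfl⟩ := (ht.2 z).mpr hz
        exact .inl ⟨w, by rw [pow_succ, mul_assoc]⟩
    · exact .inr ⟨v, hv.trans m.lt_succ_self, h⟩

theorem le_of_pow_dvd [IsDomain A] {y : A} {v m : ℕ} (hy : HasOrd t y v) (h : t ^ m ∣ y) :
    m ≤ v := by
  obtain ⟨u, rfl⟩ := hy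
  rw [Units.dvd_mul_left] at h
  have not_isUnit : ¬ IsUnit t := (ht.2 t).mp dvd_rfl
  exact (pow_dvd_pow_iff ht.1 not_isUnit).mp h

end IsUniformizingParameter

theorem HasOrd.pow_dvd {A : Type*} [CommRing A] {t y : A} {v : ℕ} (hy : HasOrd t y v) :
    t ^ v ∣ y := by
  obtain ⟨u, rfl⟩ := hy
  exact dvd_mul_left _ _

theorem mem_of_pow_dvd_of_forall_exists_hasOrd {k A : Type*} [Field k] [CommRing A] [Algebra k A]
    {t : A} (residue : ∀ z : A, ∃ a : k, t ∣ z - algebraMap k A a) {G : Submodule k A} {e c : ℕ}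
    (hG : ∀ z, t ^ c ∣ z → z ∈ G) (hord : ∀ v, e ≤ v → v < c → ∃ g ∈ G, HasOrd t g v)
    {z : A} (hz : t ^ e ∣ z) : z ∈ G := by
  induction hd : c - e generalizing e z with
  | zero => exact hG z ((pow_dvd_pow t (by omega)).trans hz)
  | succ d ih =>
    obtain ⟨g, hg, u, rfl⟩ := hord e le_rfl (by omega)
    obtain ⟨y, rfl⟩ := hz
    obtain ⟨a, y', hy'⟩ := residue (y * ↑u⁻¹)
    have remainder : t ^ e * y - a • (u * t ^ e) = t ^ (e + 1) * (y' * u) := by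
      rw [Algebra.smul_def]
      linear_combination (t ^ e * u) * hy' - t ^ e * y * u.inv_mul
    have remainder_mem : t ^ e * y - a • (u * t ^ e) ∈ G :=
      ih (fun v hv => hord v (by omega)) ⟨_, remainder⟩ (by omega)
    simpa using add_mem remainder_mem (G.smul_mem a hg)

theorem exists_sub_algebraMap_mem_maximalIdeal {k R A : Type*} [Field k] [IsAlgClosed k]
    [CommRing R] [IsLocalRing R] [CommRing A] [IsLocalRing A] [Algebra k R] [Algebra k A]
    [Algebra R A] [IsScalarTower k R A] [Algebra.IsIntegral R A] [IsLocalHom (algebraMap R A)]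
    (hR : ∀ r : R, ∃ a : k, r - algebraMap k R a ∈ maximalIdeal R) (z : A) :
    ∃ a : k, z - algebraMap k A a ∈ maximalIdeal A := by
  have surjective : Function.Surjective (algebraMap k (ResidueField R)) := by
    intro y
    obtain ⟨r, rfl⟩ := residue_surjective y
    obtain ⟨a, ha⟩ := hR r
    rw [← residue_eq_zero_iff, map_sub, sub_eq_zero] at ha
    exact ⟨a, ha.symm⟩
  have : Algebra.IsIntegral k (ResidueField R) := .of_surjective (Algebra.ofId _ _) surjective
  have : Algebra.IsIntegral A (ResidueField A) :=
    .of_surjective (Algebra.ofId _ _) residue_surjective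
  have : Algebra.IsIntegral R (ResidueField A) := .trans A
  have : Algebra.IsIntegral (ResidueField R) (ResidueField A) := .tower_top R
  have : Algebra.IsIntegral k (ResidueField A) := .trans (ResidueField R)
  obtain ⟨a, ha⟩ :=
    (IsAlgClosed.algebraMap_bijective_of_isIntegral (k := k)).surjective (residue A z)
  refine ⟨a, ?_⟩
  rw [← residue_eq_zero_iff, map_sub, sub_eq_zero]
  exact ha.symm

end Uniformizer

section Conductor

open IsLocalRing

variable {R : Type*} [CommRing R] [IsDomain R] {t : normalization R} {c : ℕ}

theorem exists_mem_conductorIdeal {y : FractionRing R} (hy : y ∈ fracConductor R) :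
    ∃ r ∈ conductorIdeal R, algebraMap R (FractionRing R) r = y := by
  have := Submodule.mem_div_iff_forall_mul_mem.mp hy 1 (one_mem (normalization R))
  rw [mul_one, Submodule.mem_one] at this
  obtain ⟨r, rfl⟩ := this
  exact ⟨r, hy, rfl⟩

theorem mul_mem_fracConductor {y : FractionRing R} (hy : y ∈ fracConductor R)
    (z : normalization R) : y * z ∈ fracConductor R := by
  rw [fracConductor, Submodule.mem_div_iff_forall_mul_mem] at hy ⊢
  intro w hw
  rw [mul_assoc]
  exact hy _ ((normalization R).mul_mem z.2 hw)

theorem IsConductorExponent.mem_fracConductor (hc : IsConductorExponent R t c)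
    {z : normalization R} (hz : t ^ c ∣ z) : (z : FractionRing R) ∈ fracConductor R := by
  obtain ⟨⟨r, hr, u, hu⟩, -⟩ := hc
  have dvd_z : algebraMap R (normalization R) r ∣ z := hu ▸ Units.mul_left_dvd.mpr hz
  obtain ⟨w, rfl⟩ := dvd_z
  exact mul_mem_fracConductor hr w

theorem IsConductorExponent.exists_algebraMap_eq (hc : IsConductorExponent R t c)
    {z : normalization R} (hz : t ^ c ∣ z) : ∃ r, algebraMap R (normalization R) r = z := by
  obtain ⟨r, -, hr⟩ := exists_mem_conductorIdeal (hc.mem_fracConductor hz)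
  exact ⟨r, Subtype.ext hr⟩

theorem IsConductorExponent.exists_eq_pow_mul (ht : IsUniformizingParameter t)
    (hc : IsConductorExponent R t c) {y : FractionRing R} (hy : y ∈ fracConductor R) :
    ∃ z : normalization R, y = (t ^ c * z : normalization R) := by
  obtain ⟨r, hr, rfl⟩ := exists_mem_conductorIdeal hy
  rcases ht.pow_dvd_or_hasOrd (algebraMap R _ r) c with ⟨z, hz⟩ | ⟨v, hv, hrv⟩
  · exact ⟨z, congrArg Subtype.val hz⟩
  · exact absurd (hc.2 ⟨r, hr, hrv⟩) hv.not_ge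

theorem IsConductorExponent.two_mul_le_of_conductorIdeal_le [IsLocalRing R]
    (ht : IsUniformizingParameter t) (hc : IsConductorExponent R t c) {e : ℕ}
    (hm : ∀ p ∈ maximalIdeal R, t ^ e ∣ algebraMap R (normalization R) p)
    (hC : conductorIdeal R ≤ maximalIdeal R ^ 2) : 2 * e ≤ c := by
  have le_comap : maximalIdeal R ≤
      (Ideal.span {t ^ e}).comap (algebraMap R (normalization R)) :=
    fun p hp => Ideal.mem_span_singleton.mpr (hm p hp)
  obtain ⟨⟨r, hr, hrc⟩, -⟩ := hc
  have mem_span := (Ideal.pow_right_mono le_comap 2).trans (Ideal.le_comap_pow _ 2) (hC hr)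
  rw [Ideal.mem_comap, Ideal.span_singleton_pow, Ideal.mem_span_singleton, ← pow_mul'] at mem_span
  exact ht.le_of_pow_dvd hrc mem_span

variable {e : ℕ} {x : R}

theorem exists_eq_add_of_mem_conductorTransform (ht : IsUniformizingParameter t)
    (hc : IsConductorExponent R t c) (hx : HasOrd t (algebraMap R (normalization R) x) e)
    (hec : e ≤ c) {y : FractionRing R} (hy : y ∈ conductorTransform R x) :
    ∃ (r : R) (z : normalization R), t ^ (c - e) ∣ z ∧
      y = (algebraMap R (normalization R) r + z : normalization R) := by
  induction hy using Algebra.adjoin_induction with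
  | mem y hy =>
    obtain ⟨w, hw, rfl⟩ := hy
    obtain ⟨z, rfl⟩ := hc.exists_eq_pow_mul ht hw
    obtain ⟨u, hu⟩ := hx
    have x_ne_zero : algebraMap R (FractionRing R) x ≠ 0 := fun h =>
      (mul_ne_zero u.ne_zero (pow_ne_zero e ht.1)) (hu ▸ Subtype.ext h)
    have factor : t ^ c * z = t ^ (c - e) * (↑u⁻¹ * z) * algebraMap R (normalization R) x := by
      rw [hu, ← Nat.sub_add_cancel hec, pow_add, Nat.add_sub_cancel]
      linear_combination (-t ^ (c - e) * t ^ e * z) * u.inv_mul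
    refine ⟨0, t ^ (c - e) * (↑u⁻¹ * z), dvd_mul_right _ _, ?_⟩
    rw [map_zero, zero_add, div_eq_iff x_ne_zero]
    exact congrArg Subtype.val factor
  | algebraMap r => exact ⟨r, 0, dvd_zero _, by rw [add_zero]; rfl⟩
  | add y y' _ _ h h' =>
    obtain ⟨r, z, hz, rfl⟩ := h
    obtain ⟨r', z', hz', rfl⟩ := h'
    exact ⟨r + r', z + z', dvd_add hz hz', by push_cast [map_add]; ring⟩
  | mul y y' _ _ h h' =>
    obtain ⟨r, z, hz, rfl⟩ := h
    obtain ⟨r', z', hz', rfl⟩ := h'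
    refine ⟨r * r', algebraMap R _ r * z' + algebraMap R _ r' * z + z * z',
      dvd_add (dvd_add (hz'.mul_left _) (hz.mul_left _)) (hz.mul_right _), ?_⟩
    push_cast [map_mul]
    ring

theorem conductorTransform_le_normalization (ht : IsUniformizingParameter t)
    (hc : IsConductorExponent R t c) (hx : HasOrd t (algebraMap R (normalization R) x) e)
    (hec : e ≤ c) : conductorTransform R x ≤ normalization R := by
  intro y hy
  obtain ⟨r, z, -, rfl⟩ := exists_eq_add_of_mem_conductorTransform ht hc hx hec hy
  exact Subtype.property _

theorem isLocalRing_of_le_normalization (ht : IsUniformizingParameter t)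
    {S : Subalgebra R (FractionRing R)} (hS : S ≤ normalization R) : IsLocalRing S := by
  have := ht.isLocalRing
  have isIntegral : (Subalgebra.inclusion hS).toRingHom.IsIntegral :=
    .tower_top (algebraMap R S) _ (Algebra.IsIntegral.isIntegral (R := R) (A := normalization R))
  have := isIntegral.isLocalHom (Subalgebra.inclusion_injective hS)
  exact (Subalgebra.inclusion hS).toRingHom.domain_isLocalRing

end Conductor

section ConductorTransform

open IsLocalRing

variable {k R τ : Type*} [Field k] [CommRing R] [IsDomain R] [Algebra k R] [Fintype τ]
  {t : normalization R} {c e : ℕ} {x : R} {b : τ → ℕ}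

theorem exists_eq_algebraMap_add_sum_of_pow_dvd (hc : IsConductorExponent R t c)
    (residue : ∀ z : normalization R, ∃ a : k, t ∣ z - algebraMap k (normalization R) a)
    (hb : ∀ v < c, c ≤ v + e → v ∉ valuationSemigroup R t → v ∈ Set.range b)
    {z : normalization R} (hz : t ^ (c - e) ∣ z) :
    ∃ (r : R) (q : τ → k), z = algebraMap R (normalization R) r + ∑ j, q j • t ^ b j := by
  let G : Submodule k (normalization R) :=
    LinearMap.range (IsScalarTower.toAlgHom k R (normalization R)).toLinearMap ⊔
      Submodule.span k (Set.range fun j => t ^ b j)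
  have algebraMap_mem (r : R) : algebraMap R (normalization R) r ∈ G :=
    Submodule.mem_sup_left ⟨r, rfl⟩
  have exists_hasOrd (v : ℕ) (hcv : c - e ≤ v) (hvc : v < c) : ∃ g ∈ G, HasOrd t g v := by
    by_cases hv : v ∈ valuationSemigroup R t
    · obtain ⟨r, hr⟩ := hv
      exact ⟨_, algebraMap_mem r, hr⟩
    · obtain ⟨j, rfl⟩ := hb v hvc (by omega) hv
      exact ⟨t ^ b j, Submodule.mem_sup_right (Submodule.subset_span ⟨j, rfl⟩), 1, by simp⟩
  have conductor_le (z : normalization R) (hz : t ^ c ∣ z) : z ∈ G := by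
    obtain ⟨r, rfl⟩ := hc.exists_algebraMap_eq hz
    exact algebraMap_mem r
  have z_mem : z ∈ G := mem_of_pow_dvd_of_forall_exists_hasOrd residue conductor_le exists_hasOrd hz
  obtain ⟨_, ⟨r, rfl⟩, w, hw, rfl⟩ := Submodule.mem_sup.mp z_mem
  obtain ⟨q, rfl⟩ := (Submodule.mem_span_range_iff_exists_fun k).mp hw
  exact ⟨r, q, rfl⟩

theorem isSmallExtension_conductorTransform [IsLocalRing R] (ht : IsUniformizingParameter t)
    (hc : IsConductorExponent R t c) (hx : HasOrd t (algebraMap R (normalization R) x) e)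
    (hec : 2 * e ≤ c)
    (residue : ∀ z : normalization R, ∃ a : k, t ∣ z - algebraMap k (normalization R) a)
    (hm : ∀ p ∈ maximalIdeal R, t ^ e ∣ algebraMap R (normalization R) p)
    (hb : Set.range b = {v | c ≤ v + e ∧ v < c ∧ v ∉ valuationSemigroup R t})
    {T : τ → conductorTransform R x}
    (hT : ∀ j, (T j : FractionRing R) = (t : FractionRing R) ^ b j) :
    IsSmallExtension k R T := by
  have le_add (j : τ) : c ≤ b j + e := (hb.le (Set.mem_range_self j)).1
  refine ⟨fun y => ?_, fun {p} hp j => ?_, fun i j => ?_⟩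
  · obtain ⟨r, z, hz, hy⟩ := exists_eq_add_of_mem_conductorTransform ht hc hx (by omega) y.2
    obtain ⟨r', q, hz'⟩ := exists_eq_algebraMap_add_sum_of_pow_dvd hc residue
      (fun v hvc hv h => hb.ge ⟨hv, hvc, h⟩) hz
    refine ⟨r + r', q, Subtype.ext ?_⟩
    rw [hy, hz', ← add_assoc, ← map_add]
    push_cast [hT]
    rfl
  · have dvd : t ^ c ∣ algebraMap R (normalization R) p * t ^ b j :=
      calc t ^ c ∣ t ^ e * t ^ b j := by rw [← pow_add, add_comm]; exact pow_dvd_pow t (le_add j)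
        _ ∣ _ := mul_dvd_mul_right (hm p hp) _
    obtain ⟨r, hr⟩ := hc.exists_algebraMap_eq dvd
    refine ⟨r, Subtype.ext ?_⟩
    rw [Algebra.smul_def]
    push_cast [hT]
    exact congrArg Subtype.val hr
  · have dvd : t ^ c ∣ t ^ b i * t ^ b j :=
      pow_add t _ _ ▸ pow_dvd_pow t (by linarith [le_add i, le_add j])
    obtain ⟨r, hr⟩ := hc.exists_algebraMap_eq dvd
    refine ⟨r, Subtype.ext ?_⟩
    push_cast [hT]
    exact congrArg Subtype.val hr

end ConductorTransform

section AnalyticDomain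

open MvPowerSeries IsLocalRing

theorem pow_dvd_algebraMap_of_mem_maximalIdeal {k R σ : Type*} [Field k] [CommRing R] [IsDomain R]
    [IsLocalRing R] [Algebra k R] [Finite σ] {Φ : MvPowerSeries σ k →ₐ[k] R}
    (hΦ : Function.Surjective Φ) {t : normalization R} {a : σ → ℕ}
    (hx : ∀ i, HasOrd t (algebraMap R (normalization R) (Φ (X i))) (a i)) {e : ℕ}
    (ha : ∀ i, e ≤ a i) {p : R} (hp : p ∈ maximalIdeal R) :
    t ^ e ∣ algebraMap R (normalization R) p :=
  dvd_map_of_mem_maximalIdeal hΦ _ (fun i => (pow_dvd_pow t (ha i)).trans (hx i).pow_dvd) hp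

theorem exists_dvd_sub_algebraMap {k R σ : Type*} [Field k] [IsAlgClosed k] [CommRing R]
    [IsDomain R] [IsLocalRing R] [Algebra k R] [Finite σ] {Φ : MvPowerSeries σ k →ₐ[k] R}
    (hΦ : Function.Surjective Φ) {t : normalization R} (ht : IsUniformizingParameter t)
    (z : normalization R) : ∃ a : k, t ∣ z - algebraMap k (normalization R) a := by
  have := ht.isLocalRing
  simp only [ht.dvd_iff_mem_maximalIdeal]
  refine exists_sub_algebraMap_mem_maximalIdeal (R := R) (fun r => ?_) z
  rw [maximalIdeal_eq_span_apply_X hΦ]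
  exact exists_sub_algebraMap_mem_span_apply_X hΦ r

theorem mainTheorem5_general
    {k : Type*} [Field k] (two_ne_zero : (2 : k) ≠ 0)
    {R : Type*} [CommRing R] [IsDomain R] [Algebra k R] {n : ℕ} [NeZero n]
    (Φ : MvPowerSeries (Fin n) k →ₐ[k] R) (hΦ : Function.Surjective Φ)
    (t : normalization R) (ht : IsUniformizingParameter t)
    (residue : ∀ z : normalization R, ∃ a : k, t ∣ z - algebraMap k (normalization R) a)
    (a : Fin n → ℕ) (ha : ∀ i, a 0 ≤ a i)
    (hx : ∀ i, HasOrd t (algebraMap R (normalization R) (Φ (X i))) (a i))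
    (c : ℕ) (hc : IsConductorExponent R t c) (hac : 2 * a 0 ≤ c)
    {s : ℕ} (b : Fin s → ℕ)
    (hbrange : Set.range b = {v | c ≤ v + a 0 ∧ v < c ∧ v ∉ valuationSemigroup R t})
    (Ψ : MvPowerSeries (Fin n ⊕ Fin s) k →ₐ[k] conductorTransform R (Φ (X 0)))
    (hΨX : ∀ i, (Ψ (X (.inl i)) : FractionRing R) = algebraMap R (FractionRing R) (Φ (X i)))
    (hΨT : ∀ j, (Ψ (X (.inr j)) : FractionRing R) = (t : FractionRing R) ^ b j)
    (τ : Fin (n * s + s.choose 2 + 1) → UnivFinDiff Ψ) (hτ : LinearIndependent k τ)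
    (hτtors : ∀ l, τ l ∈ Submodule.torsion (conductorTransform R (Φ (X 0))) (UnivFinDiff Ψ))
    (hτunit : ∀ l, ∃ r : Fin n ⊕ Fin s → conductorTransform R (Φ (X 0)),
      τ l = UnivFinDiff.ofCoeffs Ψ r ∧ ∀ j, ¬ IsUnit (r (.inr j))) :
    (∃ F : UnivFinDiff Φ →ₗ[R] UnivFinDiff Ψ,
      (∀ i, F (UnivFinDiff.dX Φ i) = UnivFinDiff.dX Ψ (.inl i)) ∧
      ∃ (q : Fin (n * s + s.choose 2 + 1) → k) (ω : UnivFinDiff Φ),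
        q ≠ 0 ∧ ω ∈ Submodule.torsion R (UnivFinDiff Φ) ∧ ω ≠ 0 ∧ F ω = ∑ l, q l • τ l) ∧
    Submodule.torsion R (UnivFinDiff Φ) ≠ ⊥ := by
  have : IsLocalRing R := .of_surjective' Φ.toRingHom hΦ
  have : IsNoetherianRing R := isNoetherianRing_of_surjective _ R Φ.toRingHom hΦ
  have : IsLocalRing (conductorTransform R (Φ (X 0))) :=
    isLocalRing_of_le_normalization ht
      (conductorTransform_le_normalization ht hc (hx 0) (by linarith))
  have hX (i) : Ψ (X (.inl i)) = algebraMap R _ (Φ (X i)) := Subtype.ext (hΨX i)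
  have hT : IsSmallExtension k R fun j => Ψ (X (.inr j)) :=
    isSmallExtension_conductorTransform ht hc (hx 0) hac residue
      (fun _ => pow_dvd_algebraMap_of_mem_maximalIdeal hΦ hx ha) hbrange hΨT
  have hΨ : Function.Surjective Ψ := hT.surjective hΦ hX
  have := hT.finite
  obtain ⟨q, ω, hq, hω, ω_ne_zero, map_eq⟩ := exists_torsion_map_eq_sum hΦ hX hT hΨ two_ne_zero
    (FractionRing R) (by simp) hτ hτtors hτunit
  refine ⟨⟨UnivFinDiff.map hΦ hΨ, fun i => ?_, q, ω, hq, hω, ω_ne_zero, map_eq⟩,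
    (Submodule.ne_bot_iff _).mpr ⟨ω, hω, ω_ne_zero⟩⟩
  rw [← UnivFinDiff.d_apply_X hΦ, UnivFinDiff.map_d, ← hX, UnivFinDiff.d_apply_X]

end AnalyticDomain

theorem mainTheorem5
    {k : Type*} [Field k] [IsAlgClosed k] [CharZero k]
    -- `R` is a one-dimensional complete local domain over `k` of embedding dimension `n`,
    {R : Type*} [CommRing R] [IsDomain R] [IsLocalRing R] [IsNoetherianRing R]
    [IsAdicComplete (IsLocalRing.maximalIdeal R) R] [Algebra k R]
    (hdim : ringKrullDim R = 1)
    {n : ℕ} [NeZero n] (hedim : (IsLocalRing.maximalIdeal R).spanFinrank = n)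
    -- presented by `Φ : k⟦X_1, …, X_n⟧ ↠ R`, `x_i = Φ X_i`.
    (Φ : MvPowerSeries (Fin n) k →ₐ[k] R) (hΦ : Function.Surjective Φ)
    -- In the integral closure, `x_i = α_i t ^ a_i` with `a_1 ≤ ⋯ ≤ a_n` and `α_1 = 1`.
    (t : normalization R) (ht : IsUniformizingParameter t)
    (a : Fin n → ℕ) (ha : Monotone a) (α : Fin n → (normalization R)ˣ) (hα : α 0 = 1)
    (hx : ∀ i, algebraMap R (normalization R) (Φ (MvPowerSeries.X i)) = α i * t ^ a i)
    -- The conductor lies in the square of the maximal ideal; `c` is its valuation.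
    (hC : conductorIdeal R ≤ IsLocalRing.maximalIdeal R ^ 2)
    (c : ℕ) (hc : IsConductorExponent R t c)
    -- `b_1 < ⋯ < b_s` are the integers in `[c - a_1, c - 1]` outside the valuation semigroup.
    {s : ℕ} (b : Fin s → ℕ) (hb : StrictMono b)
    (hbrange : Set.range b = {v | c ≤ v + a 0 ∧ v < c ∧ v ∉ valuationSemigroup R t})
    -- `S = R[C_R / x_1]`, presented by `X_i ↦ x_i`, `T_j ↦ t ^ b_j`.
    (Ψ : MvPowerSeries (Fin n ⊕ Fin s) k →ₐ[k]
      conductorTransform R (Φ (MvPowerSeries.X 0)))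
    (hΨX : ∀ i, (Ψ (MvPowerSeries.X (Sum.inl i)) : FractionRing R) =
      algebraMap R (FractionRing R) (Φ (MvPowerSeries.X i)))
    (hΨT : ∀ j, (Ψ (MvPowerSeries.X (Sum.inr j)) : FractionRing R) =
      (t : FractionRing R) ^ b j)
    -- `k`-linearly independent torsion elements of `Ω_S` with non-unit `dT_j`-coefficients.
    (τ : Fin (n * s + s.choose 2 + 1) → UnivFinDiff Ψ)
    (hτ : LinearIndependent k τ)
    (hτtors : ∀ l, τ l ∈ Submodule.torsion
      (conductorTransform R (Φ (MvPowerSeries.X 0))) (UnivFinDiff Ψ))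
    (hτunit : ∀ l, ∃ r : Fin n ⊕ Fin s → conductorTransform R (Φ (MvPowerSeries.X 0)),
      τ l = UnivFinDiff.ofCoeffs Ψ r ∧ ∀ j, ¬ IsUnit (r (Sum.inr j))) :
    -- `F : Ω_R → Ω_S` is the canonical map, `dx_i ↦ dx_i`.
    (∃ F : UnivFinDiff Φ →ₗ[R] UnivFinDiff Ψ,
      (∀ i, F (UnivFinDiff.dX Φ i) = UnivFinDiff.dX Ψ (Sum.inl i)) ∧
      ∃ (q : Fin (n * s + s.choose 2 + 1) → k) (ω : UnivFinDiff Φ),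
        q ≠ 0 ∧ ω ∈ Submodule.torsion R (UnivFinDiff Φ) ∧ ω ≠ 0 ∧ F ω = ∑ l, q l • τ l) ∧
    Submodule.torsion R (UnivFinDiff Φ) ≠ ⊥ := by
  have hac : 2 * a 0 ≤ c := hc.two_mul_le_of_conductorIdeal_le ht (fun _ =>
    pow_dvd_algebraMap_of_mem_maximalIdeal hΦ (fun i => ⟨α i, hx i⟩) fun i => ha (Fin.zero_le i)) hC
  exact mainTheorem5_general two_ne_zero Φ hΦ t ht (exists_dvd_sub_algebraMap hΦ ht) a
    (fun i => ha (Fin.zero_le i)) (fun i => ⟨α i, hx i⟩) c hc hac b hbrange Ψ hΨX hΨT τ hτ hτtors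
    hτunit
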